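/- Let $(\Omega,\mathcal F,\mu)$ be a complete $\sigma$-finite measure space, let $H$ be a separable real Hilbert space, and let $C\subset H$ be a closed convex set with $0\in C$; denote by $d_C$ the distance function to $C$ and by $\mathrm{proj}_C$ the projection operator onto $C$. Let $\beta\in\,]0,+\infty[$ and let $\phi\colon\mathbb R\to\mathbb R$ be even, convex, and differentiable with a $\beta$-Lipschitzian derivative. Let $\mathcal H=L^2((\Omega,\mathcal F,\mu);H)$, suppose that $\mu(\Omega)<+\infty$ or $\phi(0)=0$, and set $$h\colon\mathcal H\to\mathbb R\colon x\mapsto\int_\Omega\phi\big(d_C(x(\omega))\big)\,\mu(d\omega).$$ For a function $f$ from a real Hilbert space to $\mathbb R$, $\mathrm{prox}_f x$ denotes the unique minimizer of $y\mapsto f(y)+\tfrac12\|x-y\|^2$. Then $h$ is well defined and real-valued (that is, $\phi\circ d_C\circ x$ is $\mu$-integrable for every $x\in\mathcal H$), convex, and Fréchet differentiable with a $\beta$-Lipschitzian gradient. Moreover, for every $x\in\mathcal H$ and for $\mu$-almost every $\omega\in\Omega$, $$(\nabla h(x))(\omega)=\begin{cases}\dfrac{\phi'\big(d_C(x(\omega))\big)}{d_C(x(\omega))}\,\big(x(\omega)-\mathrm{proj}_C\,x(\omega)\big),&\text{if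 }x(\omega)\notin C;\\[2mm] 0,&\text{if }x(\omega)\in C.\end{cases}$$ Furthermore, for every $\gamma\in\,]0,+\infty[$, the proximity operators $\mathrm{prox}_{\gamma\phi}\colon\mathbb R\to\mathbb R$ and $\mathrm{prox}_{\gamma h}\colon\mathcal H\to\mathcal H$ are well defined (the unique minimizers exist), and, for every $x\in\mathcal H$ and for $\mu$-almost every $\omega\in\Omega$, $$(\mathrm{prox}_{\gamma h}x)(\omega)=\begin{cases}\mathrm{proj}_C\,x(\omega)+\dfrac{\mathrm{prox}_{\gamma\phi}\,d_C(x(\omega))}{d_C(x(\omega))}\,\big(x(\omega)-\mathrm{proj}_C\,x(\omega)\big),&\text{if }x(\omega)\notin C;\\[2mm] x(\omega),&\text{if }x(\omega)\in C.\end{cases}$$ -/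

import Mathlib

open MeasureTheory

/-- `p` is a nearest point of `C` to `x`. -/
def IsNearestPoint {E : Type*} [NormedAddCommGroup E] (C : Set E) (x p : E) : Prop :=
  p ∈ C ∧ ∀ y ∈ C, ‖x - p‖ ≤ ‖x - y‖

/-- In a Hilbert space every point has exactly one nearest point in a nonempty closed convex set. -/
theorem existsUnique_isNearestPoint {E : Type*} [NormedAddCommGroup E] [InnerProductSpace ℝ E]
    [CompleteSpace E] {C : Set E} (hne : C.Nonempty) (hcl : IsClosed C) (hc : Convex ℝ C) (x : E) :
    ∃! p, IsNearestPoint C x p := by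
  have key : ∀ p ∈ C, IsNearestPoint C x p → ∀ w ∈ C, inner ℝ (x - p) (w - p) ≤ 0 := by
    intro p hp h
    have : Nonempty C := ⟨⟨p, hp⟩⟩
    refine (norm_eq_iInf_iff_real_inner_le_zero hc hp).1 (le_antisymm ?_ ?_)
    · exact le_ciInf fun w => h.2 w.1 w.2
    · exact ciInf_le ⟨0, by rintro _ ⟨w, rfl⟩; exact norm_nonneg _⟩ (⟨p, hp⟩ : C)
  obtain ⟨p, hp, hpe⟩ := exists_norm_eq_iInf_of_complete_convex hne hcl.isComplete hc x
  have hn : IsNearestPoint C x p := by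
    refine ⟨hp, fun y hy => ?_⟩
    rw [hpe]
    exact ciInf_le ⟨0, by rintro _ ⟨w, rfl⟩; exact norm_nonneg _⟩ (⟨y, hy⟩ : C)
  refine ⟨p, hn, fun r hr => ?_⟩
  have h1 := key p hp hn r hr.1
  have h2 := key r hr.1 hr p hp
  have h3 : inner ℝ (r - p) (r - p) ≤ 0 := by
    have e : inner ℝ (r - p) (r - p) = inner ℝ (x - p) (r - p) + inner ℝ (x - r) (p - r) := by
      simp only [inner_sub_left, inner_sub_right]
      ring
    linarith
  rw [real_inner_self_eq_norm_sq] at h3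
  exact sub_eq_zero.1 (norm_eq_zero.1 (pow_eq_zero_iff two_ne_zero |>.1 (le_antisymm h3 (sq_nonneg _))))

/-- The projection operator onto `C` (meaningful when nearest points exist and are unique,
in particular for nonempty closed convex subsets of Hilbert spaces). -/
noncomputable def proj {E : Type*} [NormedAddCommGroup E] (C : Set E) (x : E) : E :=
  Classical.epsilon (IsNearestPoint C x)

theorem proj_isNearestPoint {E : Type*} [NormedAddCommGroup E] [InnerProductSpace ℝ E]
    [CompleteSpace E] {C : Set E} (hne : C.Nonempty) (hcl : IsClosed C) (hc : Convex ℝ C) (x : E) :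
    IsNearestPoint C x (proj C x) :=
  Classical.epsilon_spec (existsUnique_isNearestPoint hne hcl hc x).exists

/-- `p` is the unique minimizer of `y ↦ f y + ‖x - y‖ ^ 2 / 2`. -/
def IsProx {E : Type*} [NormedAddCommGroup E] (f : E → ℝ) (x p : E) : Prop :=
  ∀ y, y ≠ p → f p + ‖x - p‖ ^ 2 / 2 < f y + ‖x - y‖ ^ 2 / 2

/-- The proximity operator of `f` (meaningful at `x` when the unique minimizer exists). -/
noncomputable def prox {E : Type*} [NormedAddCommGroup E] (f : E → ℝ) (x : E) : E :=
  Classical.epsilon (IsProx f x)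

theorem IsProx.prox_eq {E : Type*} [NormedAddCommGroup E] {f : E → ℝ} {x p : E}
    (h : IsProx f x p) : prox f x = p := by
  by_contra hne
  have h' : IsProx f x (prox f x) := Classical.epsilon_spec ⟨p, h⟩
  exact lt_asymm (h _ hne) (h' _ (Ne.symm hne))

/-- The integral function `x ↦ ∫ φ (d_C (x ω)) μ(dω)` on `L²(Ω; H)`. -/
noncomputable def integralDist {Ω H : Type*} [MeasurableSpace Ω] [NormedAddCommGroup H]
    (μ : Measure Ω) (C : Set H) (φ : ℝ → ℝ) (x : Lp H 2 μ) : ℝ :=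
  ∫ ω, φ (Metric.infDist (x ω) C) ∂μ

/-! ### Convex functions with an everywhere defined subgradient map. -/

section Subgradient

variable {E : Type*} [NormedAddCommGroup E] [InnerProductSpace ℝ E]

/-! Everything follows from one map `G` with `f x + ⟪G x, y - x⟫ ≤ f y` for all `x`, `y`. Such an
`f` is convex; if `G` is `β`-Lipschitz, then `G` is its gradient; and a solution of `x - p = γ • G
p` is the unique proximal point of `γ f` at `x`. On `H`, `distGrad` is such a map for `φ ∘ d_C`, and
`distProx` solves the resolvent equation (`sub_distProx`). Both maps are Lipschitz and fix `0`, so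
they act on `L²` by composition; the subgradient inequality integrates and the resolvent equation
holds almost everywhere. No differentiation under the integral is needed. -/

theorem ConvexOn.of_subgradient {f : E → ℝ} {G : E → E}
    (h : ∀ x y, f x + inner ℝ (G x) (y - x) ≤ f y) : ConvexOn ℝ Set.univ f := by
  refine ⟨convex_univ, fun x _ y _ a b ha hb hab => ?_⟩
  set z := a • x + b • y with hz
  have h1 := mul_le_mul_of_nonneg_left (h z x) ha
  have h2 := mul_le_mul_of_nonneg_left (h z y) hb
  have h3 : a * inner ℝ (G z) (x - z) + b * inner ℝ (G z) (y - z) = 0 := by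
    rw [← real_inner_smul_right, ← real_inner_smul_right, ← inner_add_right]
    have : a • (x - z) + b • (y - z) = 0 := by
      have : a • (x - z) + b • (y - z) = z - (a + b) • z := by rw [hz]; module
      rw [this, hab, one_smul, sub_self]
    rw [this, inner_zero_right]
  have h4 : a * f z + b * f z = f z := by rw [← add_mul, hab, one_mul]
  simp only [smul_eq_mul]
  linarith

theorem monotone_of_subgradient {f : E → ℝ} {G : E → E}
    (h : ∀ x y, f x + inner ℝ (G x) (y - x) ≤ f y) (x y : E) :
    0 ≤ inner ℝ (G x - G y) (x - y) := by
  have h1 := h x y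
  have h2 := h y x
  have h3 : inner ℝ (G x) (y - x) = - inner ℝ (G x) (x - y) := by
    rw [← inner_neg_right, neg_sub]
  rw [inner_sub_left]
  linarith

/-- The subgradient inequalities at `x` and at `y` trap the linearization error between `0` and `⟪G
y - G x, y - x⟫ ≤ β ‖y - x‖²`. -/
theorem hasGradientAt_of_subgradient_of_lipschitzWith [CompleteSpace E] {f : E → ℝ} {G : E → E}
    {β : NNReal} (h : ∀ x y, f x + inner ℝ (G x) (y - x) ≤ f y) (hG : LipschitzWith β G) (x : E) :
    HasGradientAt f (G x) x := by
  rw [hasGradientAt_iff_isLittleO]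
  have hO : (fun y => f y - f x - inner ℝ (G x) (y - x)) =O[nhds x] fun y => ‖y - x‖ ^ 2 := by
    refine Asymptotics.IsBigO.of_bound β (Filter.Eventually.of_forall fun y => ?_)
    have h1 := h x y
    have h2 := h y x
    have h3 : inner ℝ (G y) (x - y) = - inner ℝ (G y) (y - x) := by
      rw [← inner_neg_right, neg_sub]
    have h4 : inner ℝ (G y - G x) (y - x) ≤ β * ‖y - x‖ * ‖y - x‖ :=
      (real_inner_le_norm _ _).trans
        (mul_le_mul_of_nonneg_right (hG.norm_sub_le y x) (norm_nonneg _))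
    rw [inner_sub_left] at h4
    rw [Real.norm_of_nonneg (by linarith), Real.norm_of_nonneg (sq_nonneg _)]
    nlinarith
  refine hO.trans_isLittleO ?_
  have hn : Filter.Tendsto (fun y => ‖y - x‖) (nhds x) (nhds 0) := by
    have : Continuous fun y => ‖y - x‖ := by fun_prop
    simpa using this.tendsto x
  have := (Asymptotics.isLittleO_pow_id (𝕜 := ℝ) one_lt_two).comp_tendsto hn
  exact (Asymptotics.isLittleO_norm_right.1 this)

/-- Expanding the square leaves a surplus `‖y - p‖² / 2`, which makes the minimum strict. -/
theorem isProx_of_subgradient {f : E → ℝ} {x p : E}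
    (h : ∀ y, f p + inner ℝ (x - p) (y - p) ≤ f y) : IsProx f x p := by
  intro y hy
  have h1 := h y
  have h2 : ‖x - y‖ ^ 2 = ‖x - p‖ ^ 2 - 2 * inner ℝ (x - p) (y - p) + ‖y - p‖ ^ 2 := by
    rw [← norm_sub_sq_real, sub_sub_sub_cancel_right]
  have h3 : 0 < ‖y - p‖ ^ 2 := pow_pos (norm_pos_iff.2 (sub_ne_zero.2 hy)) 2
  linarith

theorem norm_sub_le_of_monotone_resolvent {G : E → E}
    (h : ∀ x y, 0 ≤ inner ℝ (G x - G y) (x - y)) {γ : ℝ} (hγ : 0 ≤ γ) {x y p q : E}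
    (hp : x - p = γ • G p) (hq : y - q = γ • G q) : ‖p - q‖ ≤ ‖x - y‖ := by
  have e : x - y = (p - q) + γ • (G p - G q) := by
    rw [smul_sub, ← hp, ← hq]; abel
  have h1 : ‖x - y‖ ^ 2 = ‖p - q‖ ^ 2 + 2 * (γ * inner ℝ (G p - G q) (p - q))
      + ‖γ • (G p - G q)‖ ^ 2 := by
    rw [e, norm_add_sq_real, real_inner_smul_right, real_inner_comm]
  have h2 := mul_nonneg hγ (h p q)
  refine le_of_sq_le_sq ?_ (norm_nonneg _)
  nlinarith [sq_nonneg ‖γ • (G p - G q)‖]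

/-- Both squared norms split into a radial part and a multiple of the Cauchy–Schwarz gap `‖a‖ ‖b‖ -
⟪a, b⟫ ≥ 0`; the parts are compared separately. If `a = 0`, the bound on `s` forces `s = 0`, so the
zero quotient is harmless. -/
theorem norm_smul_sub_smul_le_of_radial {β s t : ℝ} {a b : E} (hβ : 0 ≤ β)
    (hs0 : 0 ≤ s) (ht0 : 0 ≤ t) (hs : s ≤ β * ‖a‖) (ht : t ≤ β * ‖b‖)
    (hst : |s - t| ≤ β * |‖a‖ - ‖b‖|) :
    ‖(s / ‖a‖) • a - (t / ‖b‖) • b‖ ≤ β * ‖a - b‖ := by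
  have aux : ∀ {r : ℝ} {c : E}, 0 ≤ r → r ≤ β * ‖c‖ → r / ‖c‖ * ‖c‖ = r := by
    intro r c h0 h1
    rcases eq_or_ne ‖c‖ 0 with h | h
    · rw [h] at h1 ⊢; linarith
    · exact div_mul_cancel₀ _ h
  have hu := aux hs0 hs
  have hv := aux ht0 ht
  have hu0 : 0 ≤ s / ‖a‖ := by positivity
  have hv0 : 0 ≤ t / ‖b‖ := by positivity
  have hu1 : s / ‖a‖ ≤ β := div_le_of_le_mul₀ (norm_nonneg _) hβ hs
  have hv1 : t / ‖b‖ ≤ β := div_le_of_le_mul₀ (norm_nonneg _) hβ ht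
  set u := s / ‖a‖
  set v := t / ‖b‖
  have hcs := real_inner_le_norm a b
  have h1 : ‖u • a - v • b‖ ^ 2 = (s - t) ^ 2 + 2 * (u * v * (‖a‖ * ‖b‖ - inner ℝ a b)) := by
    rw [norm_sub_sq_real, real_inner_smul_left, real_inner_smul_right, norm_smul, norm_smul,
      Real.norm_of_nonneg hu0, Real.norm_of_nonneg hv0, ← hu, ← hv]
    ring
  have h2 : (s - t) ^ 2 ≤ β ^ 2 * (‖a‖ - ‖b‖) ^ 2 := by
    have := pow_le_pow_left₀ (abs_nonneg _) hst 2
    rwa [mul_pow, sq_abs, sq_abs] at this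
  have h3 : u * v * (‖a‖ * ‖b‖ - inner ℝ a b) ≤ β * β * (‖a‖ * ‖b‖ - inner ℝ a b) :=
    mul_le_mul_of_nonneg_right (mul_le_mul hu1 hv1 hv0 hβ) (by linarith)
  refine le_of_sq_le_sq ?_ (by positivity)
  rw [h1, mul_pow, norm_sub_sq_real]
  linarith

end Subgradient

/-! ### The scalar function `φ` and its proximity operator. -/

section Scalar

variable {φ : ℝ → ℝ}

theorem ConvexOn.add_deriv_mul_sub_le (hc : ConvexOn ℝ Set.univ φ) (hd : Differentiable ℝ φ)
    (s t : ℝ) : φ s + deriv φ s * (t - s) ≤ φ t := by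
  rcases lt_trichotomy s t with h | h | h
  · have := hc.deriv_le_slope (Set.mem_univ s) (Set.mem_univ t) h (hd s)
    rw [slope_def_field, le_div_iff₀ (sub_pos.2 h)] at this
    linarith
  · simp [h]
  · have := hc.slope_le_deriv (Set.mem_univ t) (Set.mem_univ s) h (hd s)
    rw [slope_def_field, div_le_iff₀ (sub_pos.2 h)] at this
    linarith

theorem Function.Even.deriv_zero (he : Function.Even φ) : deriv φ 0 = 0 := by
  have h1 := deriv_comp_neg φ 0
  rw [show (fun x => φ (-x)) = φ from funext he, neg_zero] at h1
  linarith

theorem ConvexOn.monotone_deriv_of_differentiable (hc : ConvexOn ℝ Set.univ φ)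
    (hd : Differentiable ℝ φ) : Monotone (deriv φ) :=
  monotoneOn_univ.1 (hc.monotoneOn_deriv fun x _ => hd x)

theorem ConvexOn.deriv_nonneg_of_even (hc : ConvexOn ℝ Set.univ φ) (hd : Differentiable ℝ φ)
    (he : Function.Even φ) {t : ℝ} (ht : 0 ≤ t) : 0 ≤ deriv φ t :=
  he.deriv_zero ▸ hc.monotone_deriv_of_differentiable hd ht

theorem abs_deriv_le_of_even {β : NNReal} (hl : LipschitzWith β (deriv φ))
    (he : Function.Even φ) (t : ℝ) : |deriv φ t| ≤ β * |t| := by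
  simpa [he.deriv_zero] using hl.norm_sub_le t 0

theorem ConvexOn.exists_add_mul_deriv_eq (hc : ConvexOn ℝ Set.univ φ) (hd : Differentiable ℝ φ)
    (hcont : Continuous (deriv φ)) {γ : ℝ} (hγ : 0 < γ) (t : ℝ) :
    ∃ p, p + γ * deriv φ p = t := by
  have hm := hc.monotone_deriv_of_differentiable hd
  have hc' : Continuous fun p => p + γ * deriv φ p := by fun_prop
  refine hc'.surjective ?_ ?_ t
  -- Monotonicity of `φ'` bounds the map below by `p + γ φ'(0)` for `p ≥ 0`, and above by it for `p
  -- ≤ 0`.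
  · refine Filter.tendsto_atTop_mono' _ ?_
      (Filter.tendsto_atTop_add_const_right _ (γ * deriv φ 0) Filter.tendsto_id)
    filter_upwards [Filter.eventually_ge_atTop 0] with p hp
    simpa using mul_le_mul_of_nonneg_left (hm hp) hγ.le
  · refine Filter.tendsto_atBot_mono' _ ?_
      (Filter.tendsto_atBot_add_const_right _ (γ * deriv φ 0) Filter.tendsto_id)
    filter_upwards [Filter.eventually_le_atBot 0] with p hp
    simpa using mul_le_mul_of_nonneg_left (hm hp) hγ.le

theorem ConvexOn.isProx_of_add_mul_deriv_eq (hc : ConvexOn ℝ Set.univ φ)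
    (hd : Differentiable ℝ φ) {γ : ℝ} (hγ : 0 < γ) {t p : ℝ} (h : p + γ * deriv φ p = t) :
    IsProx (fun s => γ * φ s) t p := by
  refine isProx_of_subgradient fun y => ?_
  have h1 := mul_le_mul_of_nonneg_left (hc.add_deriv_mul_sub_le hd p y) hγ.le
  have h2 : inner ℝ (t - p) (y - p) = γ * (deriv φ p * (y - p)) := by
    rw [real_inner_eq_re_inner, RCLike.inner_apply]
    simp
    rw [← h]; ring
  rw [h2]
  linarith

theorem ConvexOn.prox_add_mul_deriv (hc : ConvexOn ℝ Set.univ φ) (hd : Differentiable ℝ φ)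
    (hcont : Continuous (deriv φ)) {γ : ℝ} (hγ : 0 < γ) (t : ℝ) :
    prox (fun s => γ * φ s) t + γ * deriv φ (prox (fun s => γ * φ s) t) = t := by
  obtain ⟨p, hp⟩ := hc.exists_add_mul_deriv_eq hd hcont hγ t
  rw [(hc.isProx_of_add_mul_deriv_eq hd hγ hp).prox_eq, hp]

theorem ConvexOn.prox_mem_Icc (hc : ConvexOn ℝ Set.univ φ) (hd : Differentiable ℝ φ)
    (he : Function.Even φ) (hcont : Continuous (deriv φ)) {γ : ℝ} (hγ : 0 < γ) {t : ℝ}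
    (ht : 0 ≤ t) : prox (fun s => γ * φ s) t ∈ Set.Icc 0 t := by
  have hp := hc.prox_add_mul_deriv hd hcont hγ t
  set p := prox (fun s => γ * φ s) t
  have h0 : 0 ≤ p := by
    by_contra! hneg
    have := hc.monotone_deriv_of_differentiable hd hneg.le
    rw [he.deriv_zero] at this
    nlinarith
  exact ⟨h0, by nlinarith [hc.deriv_nonneg_of_even hd he h0]⟩

end Scalar

/-! ### Projections, and the gradient and proximity operator of `φ ∘ d_C`. -/

section Projection

variable {E : Type*} [NormedAddCommGroup E] {C : Set E}

theorem IsNearestPoint.infDist_eq {x p : E} (h : IsNearestPoint C x p) :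
    Metric.infDist x C = ‖x - p‖ := by
  refine le_antisymm ?_ ?_
  · rw [← dist_eq_norm]; exact Metric.infDist_le_dist_of_mem h.1
  · refine (Metric.le_infDist ⟨p, h.1⟩).2 fun {y} hy => ?_
    rw [dist_eq_norm]; exact h.2 y hy

variable [InnerProductSpace ℝ E]

theorem IsNearestPoint.inner_le_zero (hc : Convex ℝ C) {x p : E} (h : IsNearestPoint C x p)
    {w : E} (hw : w ∈ C) : inner ℝ (x - p) (w - p) ≤ 0 := by
  have : Nonempty C := ⟨⟨p, h.1⟩⟩
  refine (norm_eq_iInf_iff_real_inner_le_zero hc h.1).1 (le_antisymm ?_ ?_) w hw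
  · exact le_ciInf fun w => h.2 w.1 w.2
  · exact ciInf_le ⟨0, by rintro _ ⟨w, rfl⟩; exact norm_nonneg _⟩ (⟨p, h.1⟩ : C)

theorem isNearestPoint_of_inner_le_zero {x p : E} (hp : p ∈ C)
    (h : ∀ w ∈ C, inner ℝ (x - p) (w - p) ≤ 0) : IsNearestPoint C x p := by
  refine ⟨hp, fun y hy => le_of_sq_le_sq ?_ (norm_nonneg _)⟩
  have h2 : ‖x - y‖ ^ 2 = ‖x - p‖ ^ 2 - 2 * inner ℝ (x - p) (y - p) + ‖y - p‖ ^ 2 := by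
    rw [← norm_sub_sq_real, sub_sub_sub_cancel_right]
  nlinarith [h y hy, sq_nonneg ‖y - p‖]

theorem IsNearestPoint.norm_residual_sub_le (hc : Convex ℝ C) {x y p q : E}
    (hp : IsNearestPoint C x p) (hq : IsNearestPoint C y q) :
    ‖(x - p) - (y - q)‖ ≤ ‖x - y‖ := by
  have h1 := hp.inner_le_zero hc hq.1
  have h2 := hq.inner_le_zero hc hp.1
  have e : x - y = ((x - p) - (y - q)) + (p - q) := by abel
  have h3 : inner ℝ ((x - p) - (y - q)) (p - q) =
      - inner ℝ (x - p) (q - p) - inner ℝ (y - q) (p - q) := by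
    rw [inner_sub_left, ← inner_neg_right, neg_sub]
  have h4 : ‖x - y‖ ^ 2 = ‖(x - p) - (y - q)‖ ^ 2
      + 2 * inner ℝ ((x - p) - (y - q)) (p - q) + ‖p - q‖ ^ 2 := by
    rw [← norm_add_sq_real, ← e]
  refine le_of_sq_le_sq ?_ (norm_nonneg _)
  nlinarith [sq_nonneg ‖p - q‖]

/-- Off `C`, this says that the unit residual is a subgradient of `d_C`; multiplying by the distance
avoids dividing by zero on `C`. -/
theorem IsNearestPoint.inner_residual_le (hc : Convex ℝ C) {x y p q : E}
    (hp : IsNearestPoint C x p) (hq : IsNearestPoint C y q) :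
    inner ℝ (x - p) (y - x) ≤ ‖x - p‖ * (‖y - q‖ - ‖x - p‖) := by
  have h1 := hp.inner_le_zero hc hq.1
  have h2 := real_inner_le_norm (x - p) (y - q)
  have e : y - x = (y - q) - (x - p) + (q - p) := by abel
  rw [e, inner_add_right, inner_sub_right, real_inner_self_eq_norm_sq]
  nlinarith

/-- The gradient of `φ ∘ d_C`. -/
noncomputable def distGrad (C : Set E) (φ : ℝ → ℝ) (x : E) : E :=
  (deriv φ (Metric.infDist x C) / Metric.infDist x C) • (x - proj C x)

/-- The proximity operator of `f ∘ d_C`. -/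
noncomputable def distProx (C : Set E) (f : ℝ → ℝ) (x : E) : E :=
  proj C x + (prox f (Metric.infDist x C) / Metric.infDist x C) • (x - proj C x)

variable [CompleteSpace E]

theorem proj_eq_of_isNearestPoint (hcl : IsClosed C) (hc : Convex ℝ C) {x p : E}
    (h : IsNearestPoint C x p) : proj C x = p :=
  (existsUnique_isNearestPoint ⟨p, h.1⟩ hcl hc x).unique
    (proj_isNearestPoint ⟨p, h.1⟩ hcl hc x) h

theorem proj_eq_self (hcl : IsClosed C) (hc : Convex ℝ C) {x : E} (hx : x ∈ C) :
    proj C x = x :=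
  proj_eq_of_isNearestPoint hcl hc ⟨hx, fun y _ => by simp⟩

theorem distGrad_of_mem (hcl : IsClosed C) (hc : Convex ℝ C) (φ : ℝ → ℝ) {x : E} (hx : x ∈ C) :
    distGrad C φ x = 0 := by
  simp [distGrad, proj_eq_self hcl hc hx]

theorem distProx_of_mem (hcl : IsClosed C) (hc : Convex ℝ C) (f : ℝ → ℝ) {x : E} (hx : x ∈ C) :
    distProx C f x = x := by
  simp [distProx, proj_eq_self hcl hc hx]

variable {φ : ℝ → ℝ}

theorem distGrad_subgradient (hne : C.Nonempty) (hcl : IsClosed C) (hc : Convex ℝ C)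
    (hφe : Function.Even φ) (hφc : ConvexOn ℝ Set.univ φ) (hφd : Differentiable ℝ φ) (x y : E) :
    φ (Metric.infDist x C) + inner ℝ (distGrad C φ x) (y - x) ≤ φ (Metric.infDist y C) := by
  have hx := proj_isNearestPoint hne hcl hc x
  have hy := proj_isNearestPoint hne hcl hc y
  have h1 := hx.inner_residual_le hc hy
  rw [← hx.infDist_eq, ← hy.infDist_eq] at h1
  have h2 := hφc.add_deriv_mul_sub_le hφd (Metric.infDist x C) (Metric.infDist y C)
  have h3 := hφc.deriv_nonneg_of_even hφd hφe (Metric.infDist_nonneg (x := x) (s := C))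
  have h4 : 0 ≤ Metric.infDist x C := Metric.infDist_nonneg
  rw [distGrad, real_inner_smul_left]
  have h5 := mul_le_mul_of_nonneg_left h1 (div_nonneg h3 h4)
  rcases h4.eq_or_lt with h | h
  -- At distance zero the quotient is `0` by convention, and `φ'(0) = 0` makes `φ 0` a minimum.
  · rw [← h] at h2 ⊢
    rw [hφe.deriv_zero] at h2
    simpa using h2
  · rw [← mul_assoc, div_mul_cancel₀ _ h.ne'] at h5
    linarith

theorem lipschitzWith_distGrad (hne : C.Nonempty) (hcl : IsClosed C) (hc : Convex ℝ C)
    (hφe : Function.Even φ) (hφc : ConvexOn ℝ Set.univ φ) (hφd : Differentiable ℝ φ)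
    {β : NNReal} (hl : LipschitzWith β (deriv φ)) : LipschitzWith β (distGrad C φ) := by
  refine LipschitzWith.of_dist_le_mul fun x y => ?_
  have hx := proj_isNearestPoint hne hcl hc x
  have hy := proj_isNearestPoint hne hcl hc y
  rw [dist_eq_norm, dist_eq_norm, distGrad, distGrad, hx.infDist_eq, hy.infDist_eq]
  have hle : ∀ v : E, deriv φ ‖v‖ ≤ β * ‖v‖ := fun v =>
    (le_abs_self _).trans ((abs_deriv_le_of_even hl hφe _).trans_eq (by rw [abs_norm]))
  refine (norm_smul_sub_smul_le_of_radial β.2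
    (hφc.deriv_nonneg_of_even hφd hφe (norm_nonneg _))
    (hφc.deriv_nonneg_of_even hφd hφe (norm_nonneg _)) (hle _) (hle _) ?_).trans ?_
  · exact hl.norm_sub_le _ _
  · exact mul_le_mul_of_nonneg_left (hx.norm_residual_sub_le hc hy) β.2

/-- Moving `x` along the ray from its projection `p` keeps `p` as nearest point. Both sides are thus
multiples of `x - p`, and the equation reduces to the scalar one, `q + γ φ'(q) = d`. -/
theorem sub_distProx (hne : C.Nonempty) (hcl : IsClosed C) (hc : Convex ℝ C)
    (hφe : Function.Even φ) (hφc : ConvexOn ℝ Set.univ φ) (hφd : Differentiable ℝ φ)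
    (hcont : Continuous (deriv φ)) {γ : ℝ} (hγ : 0 < γ) (x : E) :
    x - distProx C (fun s => γ * φ s) x = γ • distGrad C φ (distProx C (fun s => γ * φ s) x) := by
  by_cases hxC : x ∈ C
  · rw [distProx_of_mem hcl hc _ hxC, distGrad_of_mem hcl hc _ hxC, sub_self, smul_zero]
  have hx := proj_isNearestPoint hne hcl hc x
  have hdpos : 0 < Metric.infDist x C := (hcl.notMem_iff_infDist_pos hne).1 hxC
  have hq := hφc.prox_mem_Icc hφd hφe hcont hγ hdpos.le
  have hqe := hφc.prox_add_mul_deriv hφd hcont hγ (Metric.infDist x C)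
  have hxd := hx.infDist_eq
  rw [distProx]
  set d := Metric.infDist x C
  set q := prox (fun s => γ * φ s) d
  set p := proj C x
  set z := p + (q / d) • (x - p) with hz
  have hzp : z - p = (q / d) • (x - p) := by rw [hz]; abel
  have hzn : IsNearestPoint C z p := by
    refine isNearestPoint_of_inner_le_zero hx.1 fun w hw => ?_
    rw [hzp, real_inner_smul_left]
    exact mul_nonpos_of_nonneg_of_nonpos (div_nonneg hq.1 hdpos.le) (hx.inner_le_zero hc hw)
  have hzd : Metric.infDist z C = q := by
    rw [hzn.infDist_eq, hzp, norm_smul, ← hxd, Real.norm_of_nonneg (div_nonneg hq.1 hdpos.le),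
      div_mul_cancel₀ _ hdpos.ne']
  rw [distGrad, proj_eq_of_isNearestPoint hcl hc hzn, hzd, hzp, smul_smul, smul_smul]
  have hl : x - z = (1 - q / d) • (x - p) := by rw [hz]; module
  rw [hl]
  congr 1
  -- Since `φ'(0) = 0`, the value `q = 0` would force `d = 0`.
  rcases eq_or_ne q 0 with h0 | h0
  · rw [h0, hφe.deriv_zero, mul_zero, add_zero] at hqe
    exact absurd hqe hdpos.ne
  · field_simp
    linarith

theorem lipschitzWith_distProx (hne : C.Nonempty) (hcl : IsClosed C) (hc : Convex ℝ C)
    (hφe : Function.Even φ) (hφc : ConvexOn ℝ Set.univ φ) (hφd : Differentiable ℝ φ)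
    (hcont : Continuous (deriv φ)) {γ : ℝ} (hγ : 0 < γ) :
    LipschitzWith 1 (distProx C (fun s => γ * φ s)) := by
  refine LipschitzWith.of_dist_le_mul fun x y => ?_
  rw [dist_eq_norm, dist_eq_norm, NNReal.coe_one, one_mul]
  exact norm_sub_le_of_monotone_resolvent
    (monotone_of_subgradient (distGrad_subgradient hne hcl hc hφe hφc hφd)) hγ.le
    (sub_distProx hne hcl hc hφe hφc hφd hcont hγ x)
    (sub_distProx hne hcl hc hφe hφc hφd hcont hγ y)

end Projection

/-! ### Passage from `H` to `L²`. -/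

section Integral

variable {Ω H : Type*} [MeasurableSpace Ω] {μ : Measure Ω} [NormedAddCommGroup H]
  {C : Set H} {φ : ℝ → ℝ}

/-- Convexity and `φ'(0) = 0` give `0 ≤ φ d - φ 0 ≤ d φ'(d) ≤ β d²`, and `d ≤ ‖x ω‖` because `0 ∈
C`. The alternative `hfin` handles the constant `φ 0`. -/
theorem integrable_comp_infDist (hC0 : (0 : H) ∈ C) (hφe : Function.Even φ)
    (hφc : ConvexOn ℝ Set.univ φ) (hφd : Differentiable ℝ φ) {β : NNReal}
    (hl : LipschitzWith β (deriv φ)) (hfin : μ Set.univ < ⊤ ∨ φ 0 = 0) (x : Lp H 2 μ) :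
    Integrable (fun ω => φ (Metric.infDist (x ω) C)) μ := by
  have hconst : Integrable (fun _ : Ω => φ 0) μ := by
    rcases hfin with h | h
    · have : IsFiniteMeasure μ := ⟨h⟩
      exact integrable_const _
    · simp [h]
  have hsq : Integrable (fun ω => β * ‖x ω‖ ^ 2) μ :=
    ((memLp_two_iff_integrable_sq_norm (Lp.aestronglyMeasurable x)).1 (Lp.memLp x)).const_mul _
  have hcont : Continuous fun v : H => φ (Metric.infDist v C) :=
    hφd.continuous.comp (Metric.continuous_infDist_pt C)
  have hdiff : Integrable (fun ω => φ (Metric.infDist (x ω) C) - φ 0) μ := by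
    refine hsq.mono' ((hcont.comp_aestronglyMeasurable (Lp.aestronglyMeasurable x)).sub
      aestronglyMeasurable_const) (Filter.Eventually.of_forall fun ω => ?_)
    have h0 : 0 ≤ Metric.infDist (x ω) C := Metric.infDist_nonneg
    have h1 : Metric.infDist (x ω) C ≤ ‖x ω‖ := by
      simpa using Metric.infDist_le_dist_of_mem (x := x ω) hC0
    set d := Metric.infDist (x ω) C
    have h2 := hφc.add_deriv_mul_sub_le hφd 0 d
    have h3 := hφc.add_deriv_mul_sub_le hφd d 0
    have h4 := (le_abs_self _).trans (abs_deriv_le_of_even hl hφe d)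
    rw [abs_of_nonneg h0] at h4
    rw [hφe.deriv_zero] at h2
    rw [Real.norm_of_nonneg (by linarith)]
    have h5 : deriv φ d * d ≤ β * d * d := mul_le_mul_of_nonneg_right h4 h0
    have h6 : (β : ℝ) * d ^ 2 ≤ β * ‖x ω‖ ^ 2 :=
      mul_le_mul_of_nonneg_left (pow_le_pow_left₀ h0 h1 2) β.2
    nlinarith
  exact (hdiff.add hconst).congr (Filter.Eventually.of_forall fun ω => sub_add_cancel _ _)

variable [InnerProductSpace ℝ H]

theorem integral_subgradient {g : H → ℝ} {G : H → H}
    (h : ∀ x y, g x + inner ℝ (G x) (y - x) ≤ g y) {x y z : Lp H 2 μ}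
    (hx : Integrable (fun ω => g (x ω)) μ) (hy : Integrable (fun ω => g (y ω)) μ)
    (hz : ∀ᵐ ω ∂μ, z ω = G (x ω)) :
    ∫ ω, g (x ω) ∂μ + inner ℝ z (y - x) ≤ ∫ ω, g (y ω) ∂μ := by
  have hi := L2.integrable_inner (𝕜 := ℝ) z (y - x)
  rw [L2.inner_def, ← integral_add hx hi]
  refine integral_mono_ae (hx.add hi) hy ?_
  filter_upwards [hz, Lp.coeFn_sub y x] with ω h1 h2
  change g (x ω) + inner ℝ (z ω) ((y - x : Lp H 2 μ) ω) ≤ g (y ω)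
  rw [h1, h2]
  exact h (x ω) (y ω)

end Integral

theorem mainTheorem5 {Ω H : Type*} [MeasurableSpace Ω] (μ : Measure Ω)
    [μ.IsComplete] [SigmaFinite μ]
    [NormedAddCommGroup H] [InnerProductSpace ℝ H] [CompleteSpace H]
    [TopologicalSpace.SeparableSpace H]
    (C : Set H) (hCclosed : IsClosed C) (hCconvex : Convex ℝ C) (hC0 : (0 : H) ∈ C)
    (β : NNReal) (hβ : 0 < β)
    (φ : ℝ → ℝ) (hφeven : Function.Even φ) (hφconvex : ConvexOn ℝ Set.univ φ)
    (hφdiff : Differentiable ℝ φ) (hφlip : LipschitzWith β (deriv φ))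
    (hfin : μ Set.univ < ⊤ ∨ φ 0 = 0) :
    -- the integral defining `h` converges, so that `h` is real-valued
    (∀ x : Lp H 2 μ, Integrable (fun ω => φ (Metric.infDist (x ω) C)) μ) ∧
    ConvexOn ℝ Set.univ (integralDist μ C φ) ∧
    Differentiable ℝ (integralDist μ C φ) ∧
    LipschitzWith β (gradient (integralDist μ C φ)) ∧
    (∀ x : Lp H 2 μ, ∀ᵐ ω ∂μ,
      (x ω ∉ C → gradient (integralDist μ C φ) x ω =
        (deriv φ (Metric.infDist (x ω) C) / Metric.infDist (x ω) C) • (x ω - proj C (x ω))) ∧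
      (x ω ∈ C → gradient (integralDist μ C φ) x ω = 0)) ∧
    (∀ γ : ℝ, 0 < γ →
      -- the two proximity operators are well defined
      (∀ t : ℝ, IsProx (fun s => γ * φ s) t (prox (fun s => γ * φ s) t)) ∧
      (∀ x : Lp H 2 μ, IsProx (fun y => γ * integralDist μ C φ y) x
        (prox (fun y => γ * integralDist μ C φ y) x)) ∧
      (∀ x : Lp H 2 μ, ∀ᵐ ω ∂μ,
        (x ω ∉ C → prox (fun y => γ * integralDist μ C φ y) x ω =
          proj C (x ω) +
            (prox (fun s => γ * φ s) (Metric.infDist (x ω) C) / Metric.infDist (x ω) C) •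
              (x ω - proj C (x ω))) ∧
        (x ω ∈ C → prox (fun y => γ * integralDist μ C φ y) x ω = x ω))) := by
  have hne : C.Nonempty := ⟨0, hC0⟩
  have hint := integrable_comp_infDist hC0 hφeven hφconvex hφdiff hφlip hfin (C := C)
  have hsub := distGrad_subgradient hne hCclosed hCconvex hφeven hφconvex hφdiff
  have hGlip := lipschitzWith_distGrad hne hCclosed hCconvex hφeven hφconvex hφdiff hφlip
  have hG0 : distGrad C φ 0 = 0 := distGrad_of_mem hCclosed hCconvex φ hC0
  set G : Lp H 2 μ → Lp H 2 μ := hGlip.compLp hG0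
  have hGae : ∀ x : Lp H 2 μ, ∀ᵐ ω ∂μ, G x ω = distGrad C φ (x ω) := hGlip.coeFn_compLp hG0
  have hS : ∀ x y : Lp H 2 μ,
      integralDist μ C φ x + inner ℝ (G x) (y - x) ≤ integralDist μ C φ y := fun x y =>
    integral_subgradient hsub (hint x) (hint y) (hGae x)
  have hL : LipschitzWith β G := hGlip.lipschitzWith_compLp hG0
  have hgrad := hasGradientAt_of_subgradient_of_lipschitzWith hS hL
  have hgradeq : gradient (integralDist μ C φ) = G := gradient_eq hgrad
  have hcont := hφlip.continuous
  refine ⟨hint, .of_subgradient hS, fun x => (hgrad x).differentiableAt, hgradeq ▸ hL,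
    fun x => ?_, fun γ hγ => ?_⟩
  · rw [hgradeq]
    filter_upwards [hGae x] with ω hω
    exact ⟨fun _ => hω, fun h => hω.trans (distGrad_of_mem hCclosed hCconvex φ h)⟩
  · have hQlip := lipschitzWith_distProx hne hCclosed hCconvex hφeven hφconvex hφdiff hcont hγ
    have hQ0 := distProx_of_mem hCclosed hCconvex (fun s => γ * φ s) hC0
    set Q : Lp H 2 μ → Lp H 2 μ := hQlip.compLp hQ0
    have hQae : ∀ x : Lp H 2 μ, ∀ᵐ ω ∂μ, Q x ω = distProx C (fun s => γ * φ s) (x ω) :=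
      hQlip.coeFn_compLp hQ0
    -- The pointwise resolvent equation becomes one in `L²`, so `Q x` is the proximal point by the
    -- same subgradient criterion.
    have hres : ∀ x, x - Q x = γ • G (Q x) := fun x => by
      refine Lp.ext ?_
      filter_upwards [Lp.coeFn_sub x (Q x), Lp.coeFn_smul γ (G (Q x)), hQae x, hGae (Q x)]
        with ω h1 h2 h3 h4
      rw [h1, h2, Pi.sub_apply, Pi.smul_apply, h4, h3]
      exact sub_distProx hne hCclosed hCconvex hφeven hφconvex hφdiff hcont hγ (x ω)
    have hprox : ∀ x, IsProx (fun y => γ * integralDist μ C φ y) x (Q x) := fun x => by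
      refine isProx_of_subgradient fun y => ?_
      rw [hres, real_inner_smul_left, ← mul_add]
      exact mul_le_mul_of_nonneg_left (hS (Q x) y) hγ.le
    refine ⟨fun t => ?_, fun x => (hprox x).prox_eq.symm ▸ hprox x, fun x => ?_⟩
    · exact hφconvex.isProx_of_add_mul_deriv_eq hφdiff hγ
        (hφconvex.prox_add_mul_deriv hφdiff hcont hγ t)
    · rw [(hprox x).prox_eq]
      filter_upwards [hQae x] with ω hω
      exact ⟨fun _ => hω, fun h => hω.trans (distProx_of_mem hCclosed hCconvex _ h)⟩
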